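/- Let $F\subseteq E$ be a field extension, let $1\le k\le n$ be integers, let $e_1<e_2<\cdots<e_k$ be integers, and let $\alpha_1,\dots,\alpha_n\in E$ be algebraically independent over $F$. Let $V\in E^{k\times n}$ be the matrix with entries $V_{ij}=\alpha_j^{e_i}$, and let $I_n$ be the $n\times n$ identity matrix. Then for every $\ell\ge 1$ the pair $(V^T,I_n)$ is a $(k,n,n)$-$\operatorname{MDSb}(\ell)$ code. Here, for matrices $U\in K^{m\times b}$ and $G\in K^{m\times n}$ over a field $K$ (with $b\le m$), the pair $(U,G)$ is called $(b,n,m)$-$\operatorname{MDSb}(\ell)$ if for all $\sigma_1,\dots,\sigma_\ell\in\{0,1,\dots,b\}$ and all $A_1,\dots,A_\ell\subseteq\{1,\dots,n\}$, \[ \dim\Bigl(\bigcap_{i=1}^{\ell}\bigl(U_{\le\sigma_i}+G_{A_i}\bigr)\Bigr)=\dim\Bigl(\bigcap_{i=1}^{\ell}\bigl(W_{\le\sigma_i}+W'_{A_i}\bigr)\Bigr), \] where $U_{\le\sigma}$ denotes the span of the first $\sigma$ columns of $U$, $G_A$ denotes the span of the columns of $G$ with index in $A$, and $W$, $W'$ are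 the $m\times b$ and $m\times n$ matrices whose $mb+mn$ entries are distinct independent variables, the right-hand dimension being taken over the field of rational functions over $K$ in these variables. -/

import Mathlib

noncomputable section

namespace HigherOrderMDS

/-- `M_A`: the span of the columns of `M` whose index lies in `A`. -/
def colSpan {K : Type*} [Field K] {m n : ℕ} (M : Matrix (Fin m) (Fin n) K)
    (A : Finset (Fin n)) : Submodule K (Fin m → K) :=
  Submodule.span K ((fun j : Fin n => M.col j) '' (A : Set (Fin n)))

/-- `M_{≤ σ}`: the span of the first `σ` columns of `M`. -/
def flagSpan {K : Type*} [Field K] {m b : ℕ} (M : Matrix (Fin m) (Fin b) K)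
    (σ : ℕ) : Submodule K (Fin m → K) :=
  Submodule.span K {v | ∃ j : Fin b, (j : ℕ) < σ ∧ v = M.col j}

/-- The subspace `⋂_{i < ℓ} (U_{≤ σ_i} + V_{A_i})` attached to a configuration
`(σ_1, A_1), …, (σ_ℓ, A_ℓ)`. -/
def configInter {K : Type*} [Field K] {k b n ℓ : ℕ} (U : Matrix (Fin k) (Fin b) K)
    (V : Matrix (Fin k) (Fin n) K) (σ : Fin ℓ → ℕ) (A : Fin ℓ → Finset (Fin n)) :
    Submodule K (Fin k → K) :=
  ⨅ i, (flagSpan U (σ i) ⊔ colSpan V (A i))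

/-- The field of rational functions over `K` in `k * b + k * n` independent variables, one for
each entry of a `k × b` matrix and one for each entry of a `k × n` matrix. -/
abbrev GenericField (K : Type*) [Field K] (k b n : ℕ) : Type _ :=
  FractionRing (MvPolynomial ((Fin k × Fin b) ⊕ (Fin k × Fin n)) K)

/-- The generic `k × b` matrix `W`: its entries are the first group of variables. -/
def genericBasis (K : Type*) [Field K] (k b n : ℕ) :
    Matrix (Fin k) (Fin b) (GenericField K k b n) :=
  Matrix.of fun i j => algebraMap _ _
    (MvPolynomial.X (Sum.inl (i, j)) : MvPolynomial ((Fin k × Fin b) ⊕ (Fin k × Fin n)) K)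

/-- The generic `k × n` matrix `W'`: its entries are the second group of variables. -/
def genericGenerator (K : Type*) [Field K] (k b n : ℕ) :
    Matrix (Fin k) (Fin n) (GenericField K k b n) :=
  Matrix.of fun i j => algebraMap _ _
    (MvPolynomial.X (Sum.inr (i, j)) : MvPolynomial ((Fin k × Fin b) ⊕ (Fin k × Fin n)) K)

/-- `(U, V)` is a `(b, n, k)`-order-`ℓ` higher order MDS code with a basis: every order-`ℓ`
configuration gives an intersection of the same dimension as for generic matrices `W`, `W'`. -/
def IsMDSb {K : Type*} [Field K] {k b n : ℕ} (ℓ : ℕ) (U : Matrix (Fin k) (Fin b) K)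
    (V : Matrix (Fin k) (Fin n) K) : Prop :=
  ∀ (σ : Fin ℓ → ℕ) (A : Fin ℓ → Finset (Fin n)), (∀ i, σ i ≤ b) →
    Module.finrank K (configInter U V σ A) =
      Module.finrank (GenericField K k b n)
        (configInter (genericBasis K k b n) (genericGenerator K k b n) σ A)

/-- The `k × n` matrix with entries `α_j ^ e_i`. -/
def monomialMatrix {K : Type*} [Field K] {k n : ℕ} (e : Fin k → ℤ) (α : Fin n → K) :
    Matrix (Fin k) (Fin n) K :=
  Matrix.of fun i j => α j ^ e i

end HigherOrderMDS

end

/-!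
Write `V_{≤ σ}` for the span of the first `σ` columns of the `n × k` matrix `(α_l ^ e_s)`.  The
orthogonal complement of `V_{≤ σ} + ⟨e_a : a ∈ A⟩` is the space `relSpace` of the vectors supported
on `B = Aᶜ` that are orthogonal to the first `σ` columns, so the theorem compares the dimension of
a sum of such relation spaces with that of the corresponding sum for a generic matrix
(`finrank_configInter_one`); a generic pair `(W, W')` is first moved to `(W'⁻¹ W, 1)`.

The generic dimension is at least the special one because relations lift along a specialization
(`exists_lift_relation`, `finrank_iSup_le_of_lift`).  Conversely, choose a basis of the generic sum
consisting of circuits, that is, relations with supports of size `σ + 1`.  Circuits of any subfamily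
lie in the relation space of the union of the supports `B t` and the least `σ t`, whence a
Hall-type inequality `HallCond`.

The heart of the matter is that `HallCond` suffices for the powers of algebraically independent
points (`sum_le_finrank_iSup_relSpace`), by induction on the number of points and of pairs
`(B t, σ t)`.  If a proper subfamily with at least two members meets its bound with equality, then
by induction it spans a single relation space, and that space replaces it.  Otherwise pick a pair
`(B i, σ i)` with `σ i` least and a point `j ∈ B i`, and let `α j` tend to infinity.  Row `j` is then
dominated by its last relevant entry, so that a relation space `(B, σ)` with `j ∈ B` degenerates to
`(B \ {j}, σ - 1)` while the others do not change (`finrank_iSup_erase_le`).  The choice of `j`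
makes the inequality survive (`HallCond.erase`): proper subfamilies have room to spare, and for the
whole family the least `σ` drops together with the number of points.  When that least `σ` is
already `0`, the basis vector `e_j` itself lies in the sum, which makes up for the dimension lost.
-/

noncomputable section

/-! ### Relation spaces and specialization -/

namespace MonomialCode

open Finset Module

variable {ι : Type*} [Fintype ι]

/-- The linear relations supported on `B` among the rows of the first `σ` columns of `M`: the
vectors `u` that vanish outside `B` and are orthogonal to columns `0, …, σ - 1` of `M`.  Columns
are indexed by `ℕ`, so that `σ` is unrestricted. -/
def relSpace {K : Type*} [Field K] (M : ι → ℕ → K) (B : Finset ι) (σ : ℕ) :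
    Submodule K (ι → K) where
  carrier := {u | (∀ l, l ∉ B → u l = 0) ∧ ∀ s < σ, ∑ l, u l * M l s = 0}
  zero_mem' := by simp
  add_mem' := by
    rintro u v ⟨hu, hu'⟩ ⟨hv, hv'⟩
    refine ⟨fun l hl => by simp [hu l hl, hv l hl], fun s hs => ?_⟩
    simp [add_mul, sum_add_distrib, hu' s hs, hv' s hs]
  smul_mem' := by
    rintro c u ⟨hu, hu'⟩
    refine ⟨fun l hl => by simp [hu l hl], fun s hs => ?_⟩
    simp [mul_assoc, ← mul_sum, hu' s hs]

lemma mem_relSpace {K : Type*} [Field K] {M : ι → ℕ → K} {B : Finset ι} {σ : ℕ} {u : ι → K} :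
    u ∈ relSpace M B σ ↔ (∀ l, l ∉ B → u l = 0) ∧ ∀ s < σ, ∑ l, u l * M l s = 0 := Iff.rfl

lemma relSpace_mono {K : Type*} [Field K] {M : ι → ℕ → K} {B B' : Finset ι} {σ σ' : ℕ}
    (hB : B ⊆ B') (hσ : σ' ≤ σ) : relSpace M B σ ≤ relSpace M B' σ' :=
  fun _ hu => ⟨fun l hl => hu.1 l fun h => hl (hB h), fun s hs => hu.2 s (hs.trans_le hσ)⟩

/-- The rows of `M` indexed by `B`, cut to the first `σ` columns, span everything. -/
def FullRank {R : Type*} [CommRing R] (M : ι → ℕ → R) (B : Finset ι) (σ : ℕ) : Prop :=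
  ∀ r : ℕ → R, ∃ a : ι → R, (∀ l, l ∉ B → a l = 0) ∧ ∀ s < σ, ∑ l, a l * M l s = r s

lemma finrank_relSpace_add {K : Type*} [Field K] {M : ι → ℕ → K} {B : Finset ι} {σ : ℕ}
    (h : FullRank M B σ) : finrank K (relSpace M B σ) + σ = #B := by
  classical
  let ext : (B → K) →ₗ[K] (ι → K) :=
    { toFun := fun v l => if hl : l ∈ B then v ⟨l, hl⟩ else 0
      map_add' := fun v w => by ext l; by_cases hl : l ∈ B <;> simp [hl]
      map_smul' := fun c v => by ext l; by_cases hl : l ∈ B <;> simp [hl] }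
  let f : (ι → K) →ₗ[K] (Fin σ → K) :=
    { toFun := fun u s => ∑ l, u l * M l s
      map_add' := fun v w => by ext l; simp [add_mul, sum_add_distrib]
      map_smul' := fun c v => by ext l; simp [mul_assoc, ← mul_sum] }
  have ext_res : ∀ u : ι → K, (∀ l, l ∉ B → u l = 0) → ext (fun l => u l) = u := by
    intro u hu
    ext l
    by_cases hl : l ∈ B
    · simp [ext, hl]
    · simp [ext, hl, hu l hl]
  have ext_inj : Function.Injective ext := by
    intro v w hvw
    ext ⟨l, hl⟩
    simpa [ext, hl] using congrFun hvw l
  have hsurj : Function.Surjective (f ∘ₗ ext) := by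
    intro r
    obtain ⟨a, ha, ha'⟩ := h fun s => if hs : s < σ then r ⟨s, hs⟩ else 0
    refine ⟨fun l => a l, ?_⟩
    rw [LinearMap.comp_apply, ext_res a ha]
    ext s
    simpa [f] using ha' s s.2
  have hmap : (LinearMap.ker (f ∘ₗ ext)).map ext = relSpace M B σ := by
    ext u
    constructor
    · rintro ⟨v, hv, rfl⟩
      refine ⟨fun l hl => by simp [ext, hl], fun s hs => ?_⟩
      exact congrFun (LinearMap.mem_ker.1 hv) ⟨s, hs⟩
    · rintro ⟨hu, hu'⟩
      refine ⟨fun l => u l, ?_, ext_res u hu⟩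
      rw [SetLike.mem_coe, LinearMap.mem_ker, LinearMap.comp_apply, ext_res u hu]
      ext s
      exact hu' s s.2
  have h1 := (f ∘ₗ ext).finrank_range_add_finrank_ker
  rw [LinearMap.range_eq_top.2 hsurj, finrank_top, finrank_pi, finrank_pi, Fintype.card_fin,
    Fintype.card_coe] at h1
  rw [← hmap, ← (Submodule.equivMapOfInjective ext ext_inj _).finrank_eq]
  omega

/-- Relations lift along a split surjection `φ : R → k`: the obstruction is removed by Cramer's
rule, at the cost of a factor that `φ` sends to `1`. -/
lemma exists_lift_relation {R k : Type*} [CommRing R] [Field k] (φ : R →+* k) (c : k →+* R)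
    (hc : ∀ x, φ (c x) = x) (M : ι → ℕ → R) {B : Finset ι} {σ : ℕ}
    (h : FullRank (fun l s => φ (M l s)) B σ) {u : ι → k}
    (hu : u ∈ relSpace (fun l s => φ (M l s)) B σ) :
    ∃ v : ι → R, (∀ l, φ (v l) = u l) ∧ (∀ l, l ∉ B → v l = 0) ∧
      ∀ s < σ, ∑ l, v l * M l s = 0 := by
  classical
  choose a ha ha' using fun t : Fin σ => h fun s => if s = t then 1 else 0
  let N : Matrix (Fin σ) (Fin σ) R := Matrix.of fun t s => ∑ l, c (a t l) * M l s
  have hN : N.map φ = 1 := by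
    ext t s
    simp [N, hc, ha' t s s.2, Matrix.one_apply, Fin.ext_iff, eq_comm]
  have hdet : φ N.det = 1 := by
    rw [RingHom.map_det, RingHom.mapMatrix_apply, hN, Matrix.det_one]
  let r : Fin σ → R := fun s => ∑ l, c (u l) * M l s
  have hr : ∀ s, φ (r s) = 0 := fun s => by simpa [r, hc] using hu.2 s s.2
  let q : Fin σ → R := Matrix.vecMul r N.adjugate
  have hq : ∀ s, φ (q s) = 0 := fun s => by simp [q, Matrix.vecMul, dotProduct, hr]
  have hqN : Matrix.vecMul q N = N.det • r := by
    simp [q, Matrix.vecMul_vecMul, Matrix.adjugate_mul, Matrix.vecMul_smul]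
  refine ⟨fun l => N.det * c (u l) - ∑ t, q t * c (a t l), fun l => ?_, fun l hl => ?_,
    fun s hs => ?_⟩
  · simp [hdet, hc, hq]
  · simp [hu.1 l hl, ha _ l hl]
  · have h1 := congrFun hqN ⟨s, hs⟩
    simp only [Matrix.vecMul, dotProduct, N, Matrix.of_apply, r, Pi.smul_apply, smul_eq_mul] at h1
    simp only [sub_mul, sum_sub_distrib, mul_assoc, ← mul_sum, sum_mul]
    rw [sub_eq_zero, ← h1, sum_comm]
    simp only [mul_sum]

lemma FullRank.of_map {R k E : Type*} [CommRing R] [Field k] [Field E] (φ : R →+* k)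
    (c : k →+* R) (hc : ∀ x, φ (c x) = x) (ψ : R →+* E) (hψ : Function.Injective ψ)
    {M : ι → ℕ → R} {B : Finset ι} {σ : ℕ} (h : FullRank (fun l s => φ (M l s)) B σ) :
    FullRank (fun l s => ψ (M l s)) B σ := by
  classical
  intro r
  choose a ha ha' using fun t : Fin σ => h fun s => if s = t then 1 else 0
  let N : Matrix (Fin σ) (Fin σ) R := Matrix.of fun t s => ∑ l, c (a t l) * M l s
  have hN : N.map φ = 1 := by
    ext t s
    simp [N, hc, ha' t s s.2, Matrix.one_apply, Fin.ext_iff, eq_comm]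
  have hdet : φ N.det = 1 := by
    rw [RingHom.map_det, RingHom.mapMatrix_apply, hN, Matrix.det_one]
  have hunit : IsUnit (N.map ψ).det := by
    rw [← RingHom.mapMatrix_apply, ← RingHom.map_det, isUnit_iff_ne_zero, Ne,
      map_eq_zero_iff ψ hψ]
    intro h0
    simp [h0] at hdet
  let q : Fin σ → E := Matrix.vecMul (fun s : Fin σ => r s) (N.map ψ)⁻¹
  have hq : Matrix.vecMul q (N.map ψ) = fun s : Fin σ => r s := by
    simp [q, Matrix.vecMul_vecMul, Matrix.nonsing_inv_mul _ hunit]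
  refine ⟨fun l => ∑ t, q t * ψ (c (a t l)), fun l hl => by simp [ha _ l hl], fun s hs => ?_⟩
  have h1 := congrFun hq ⟨s, hs⟩
  simp only [Matrix.vecMul, dotProduct, N, Matrix.map_apply, Matrix.of_apply, map_sum, map_mul]
    at h1
  rw [← h1]
  simp only [sum_mul, mul_sum, mul_assoc]
  rw [sum_comm]

/-- Vectors that are independent after specialization were independent before. -/
lemma linearIndependent_of_lift {R k E : Type*} [CommRing R] [Field k] [Field E] (φ : R →+* k)
    (c : k →+* R) (hc : ∀ x, φ (c x) = x) (ψ : R →+* E) (hψ : Function.Injective ψ)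
    {τ : Type*} [Fintype τ] {u : τ → ι → k} (hu : LinearIndependent k u) (v : τ → ι → R)
    (hv : ∀ t l, φ (v t l) = u t l) : LinearIndependent E fun t l => ψ (v t l) := by
  classical
  obtain ⟨g, hg⟩ := (Fintype.linearCombination k u).exists_leftInverse_of_injective
    (LinearMap.ker_eq_bot.2 (linearIndependent_iff_injective_fintypeLinearCombination.1 hu))
  have hgu : ∀ t, g (u t) = Pi.single t 1 := fun t => by
    have := LinearMap.congr_fun hg (Pi.single t 1)
    simpa [Fintype.linearCombination_apply_single] using this
  -- `G` is a left inverse of the matrix of the `u t`; `N` is its product with the lifts.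
  let G : ι → τ → k := fun l s => g (Pi.single l 1) s
  have hG : ∀ w s, g w s = ∑ l, w l * G l s := fun w s => by
    conv_lhs => rw [← Finset.univ_sum_single w]
    rw [map_sum, Finset.sum_apply]
    refine sum_congr rfl fun l _ => ?_
    have : (Pi.single l (w l) : ι → k) = w l • Pi.single l 1 := by
      rw [← Pi.single_smul]; simp
    rw [this, map_smul]
    rfl
  let N : Matrix τ τ R := Matrix.of fun t s => ∑ l, v t l * c (G l s)
  have hN : N.map φ = 1 := by
    ext t s
    simp [N, hc, hv, ← hG, hgu, Matrix.one_apply, Pi.single_apply, eq_comm]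
  have hdet : φ N.det = 1 := by
    rw [RingHom.map_det, RingHom.mapMatrix_apply, hN, Matrix.det_one]
  have hunit : (N.map ψ).det ≠ 0 := by
    rw [← RingHom.mapMatrix_apply, ← RingHom.map_det, Ne, map_eq_zero_iff ψ hψ]
    intro h0
    simp [h0] at hdet
  rw [Fintype.linearIndependent_iff]
  intro x hx
  refine congrFun (Matrix.eq_zero_of_vecMul_eq_zero hunit (v := x) ?_)
  ext s
  have hx' : ∀ l, ∑ t, x t * ψ (v t l) = 0 := fun l => by simpa using congrFun hx l
  simp only [Matrix.vecMul, dotProduct, N, Matrix.map_apply, Matrix.of_apply, map_sum, map_mul,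
    mul_sum, ← mul_assoc]
  rw [sum_comm]
  simp [← sum_mul, hx']

/-- If every vector of a family of subspaces lifts along the specialization `φ` to a vector of `Z`,
then the sum of the family is at most as large as `Z`. -/
lemma finrank_iSup_le_of_lift {R k E : Type*} [CommRing R] [Field k] [Field E] (φ : R →+* k)
    (c : k →+* R) (hc : ∀ x, φ (c x) = x) (ψ : R →+* E) (hψ : Function.Injective ψ)
    {τ : Type*} (T : Finset τ) (Y : τ → Submodule k (ι → k)) (Z : Submodule E (ι → E))
    (h : ∀ t ∈ T, ∀ u ∈ Y t, ∃ v : ι → R, (∀ l, φ (v l) = u l) ∧ (fun l => ψ (v l)) ∈ Z) :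
    finrank k (⨆ t ∈ T, Y t : Submodule k (ι → k)) ≤ finrank E Z := by
  obtain ⟨b, hb, hspan, hli⟩ :=
    exists_linearIndependent k (⋃ t ∈ T, (Y t : Set (ι → k)))
  have hsup : (⨆ t ∈ T, Y t) = Submodule.span k b := by
    rw [hspan]
    simp [Submodule.span_iUnion]
  have : Finite b := hli.finite
  have := Fintype.ofFinite b
  have hlift : ∀ x : b, ∃ v : ι → R, (∀ l, φ (v l) = x.1 l) ∧ (fun l => ψ (v l)) ∈ Z := by
    intro x
    obtain ⟨t, ht, hx⟩ := Set.mem_iUnion₂.1 (hb x.2)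
    exact h t ht _ hx
  choose v hv hvZ using hlift
  have hli' := linearIndependent_of_lift φ c hc ψ hψ hli v hv
  have h1 : Submodule.span E (Set.range fun (t : b) l => ψ (v t l)) ≤ Z := by
    rw [Submodule.span_le]
    rintro _ ⟨x, rfl⟩
    exact hvZ x
  calc finrank k (⨆ t ∈ T, Y t : Submodule k (ι → k)) = Fintype.card b := by
        rw [hsup]
        have := finrank_span_eq_card hli
        rwa [Subtype.range_coe] at this
    _ = finrank E (Submodule.span E (Set.range fun (t : b) l => ψ (v t l))) :=
        (finrank_span_eq_card hli').symm
    _ ≤ finrank E Z := Submodule.finrank_mono h1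

/-- Every relation is a sum of relations supported on `σ + 1` rows. -/
lemma relSpace_le_iSup_circuits [DecidableEq ι] {K : Type*} [Field K] {M : ι → ℕ → K} {σ : ℕ}
    (h : ∀ B : Finset ι, ∀ s, s ≤ #B → FullRank M B s) (B : Finset ι) :
    relSpace M B σ ≤ ⨆ B' ∈ B.powersetCard (σ + 1), relSpace M B' σ := by
  have hsmall : ∀ B : Finset ι, #B ≤ σ → ∀ u ∈ relSpace M B σ, u = 0 := by
    intro B hB u hu
    have h0 : finrank K (relSpace M B #B) = 0 := by
      have := finrank_relSpace_add (h B #B le_rfl)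
      omega
    have h1 := relSpace_mono (M := M) subset_rfl hB hu
    rw [Submodule.finrank_eq_zero.1 h0] at h1
    simpa using h1
  induction hn : #B using Nat.strong_induction_on generalizing B with
  | _ n ih =>
  intro u hu
  rcases lt_trichotomy n (σ + 1) with hlt | heq | hgt
  · rw [hsmall B (by omega) u hu]
    exact zero_mem _
  · exact Submodule.mem_iSup_of_mem B (Submodule.mem_iSup_of_mem
      (mem_powersetCard.2 ⟨subset_rfl, by omega⟩) hu)
  · -- Clear one coordinate of `u` by a circuit through it.
    obtain ⟨j, hj⟩ : B.Nonempty := by rw [← card_pos]; omega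
    obtain ⟨B', hjB', hB'B, hB'⟩ := exists_subsuperset_card_eq (s := {j}) (t := B) (n := σ + 1)
      (by simpa using hj) (by simp) (by omega)
    have hjB' : j ∈ B' := by simpa using hjB'
    have hpos : 0 < finrank K (relSpace M B' σ) := by
      have := finrank_relSpace_add (h B' σ (by omega))
      omega
    obtain ⟨⟨w, hw⟩, hw0⟩ := (finrank_pos_iff_exists_ne_zero).1 hpos
    have hwj : w j ≠ 0 := by
      intro h0
      refine hw0 (Subtype.ext (hsmall (B'.erase j) ?_ w ⟨fun l hl => ?_, hw.2⟩))
      · rw [card_erase_of_mem hjB', hB']; rfl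
      · by_cases hlj : l = j
        · rw [hlj, h0]
        · exact hw.1 l fun hl' => hl (mem_erase.2 ⟨hlj, hl'⟩)
    have hdiff : u - (u j / w j) • w ∈ relSpace M (B.erase j) σ := by
      have h1 : u - (u j / w j) • w ∈ relSpace M B σ :=
        sub_mem hu (Submodule.smul_mem _ _ (relSpace_mono hB'B le_rfl hw))
      refine ⟨fun l hl => ?_, h1.2⟩
      by_cases hlj : l = j
      · subst hlj
        simp [div_mul_cancel₀ _ hwj]
      · exact h1.1 l fun hl' => hl (mem_erase.2 ⟨hlj, hl'⟩)
    have h2 := ih (#(B.erase j)) (by rw [card_erase_of_mem hj]; omega) _ rfl hdiff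
    have h3 : (⨆ B' ∈ (B.erase j).powersetCard (σ + 1), relSpace M B' σ) ≤
        ⨆ B' ∈ B.powersetCard (σ + 1), relSpace M B' σ :=
      biSup_mono fun C hC => powersetCard_mono (erase_subset j B) hC
    have h4 : (u j / w j) • w ∈ ⨆ B' ∈ B.powersetCard (σ + 1), relSpace M B' σ :=
      Submodule.smul_mem _ _ (Submodule.mem_iSup_of_mem B' (Submodule.mem_iSup_of_mem
        (mem_powersetCard.2 ⟨hB'B, hB'⟩) hw))
    simpa using add_mem (h3 h2) h4

end MonomialCode

/-! ### Powers of algebraically independent points -/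

namespace MonomialCode

open Finset Module

variable {ι : Type*} [Fintype ι]

/-- A generalized Vandermonde determinant at algebraically independent points does not vanish: the
terms of its Leibniz expansion are distinct monomials. -/
lemma det_zpow_ne_zero {F E : Type*} [Field F] [Field E] [Algebra F E] {n : ℕ} {β : Fin n → E}
    (hβ : AlgebraicIndependent F β) {e : ℕ → ℤ} (he : StrictMono e) :
    (Matrix.of fun i s : Fin n => β i ^ e s).det ≠ 0 := by
  classical
  let d : ℕ → ℕ := fun s => (e s - e 0).toNat
  have hd : ∀ s, e s = e 0 + d s := fun s => by
    have := he.monotone (Nat.zero_le s)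
    simp only [d]
    omega
  have hdinj : Function.Injective d := fun s t hst => he.injective (by rw [hd s, hd t, hst])
  have hβ0 : ∀ i, β i ≠ 0 := fun i => hβ.ne_zero i
  let P : Matrix (Fin n) (Fin n) (MvPolynomial (Fin n) F) :=
    Matrix.of fun i s => MvPolynomial.X i ^ d s
  have hP : P.det ≠ 0 := by
    intro h0
    have h1 : MvPolynomial.coeff (∑ i : Fin n, Finsupp.single i (d i)) P.det = 1 := by
      rw [Matrix.det_apply', MvPolynomial.coeff_sum, sum_eq_single 1]
      · have : ∏ i : Fin n, P ((1 : Equiv.Perm (Fin n)) i) i =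
            MvPolynomial.monomial (∑ i : Fin n, Finsupp.single i (d i)) (1 : F) := by
          simp [P, MvPolynomial.monomial_sum_one, MvPolynomial.X_pow_eq_monomial]
        rw [this]
        simp
      · intro π _ hπ
        have : ∏ i : Fin n, P (π i) i =
            MvPolynomial.monomial (∑ i : Fin n, Finsupp.single (π i) (d i)) (1 : F) := by
          simp [P, MvPolynomial.monomial_sum_one, MvPolynomial.X_pow_eq_monomial]
        rw [this, ← map_intCast (MvPolynomial.C (σ := Fin n) (R := F)), MvPolynomial.coeff_C_mul,
          MvPolynomial.coeff_monomial, if_neg, mul_zero]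
        intro heq
        refine hπ (Equiv.ext fun i => ?_)
        have h2 := DFunLike.congr_fun heq (π i)
        simp only [Finsupp.finsetSum_apply, Finsupp.single_apply, π.injective.eq_iff,
          sum_ite_eq', mem_univ, if_true] at h2
        exact (Fin.ext (hdinj h2)).symm
      · simp
    rw [h0] at h1
    simp at h1
  have hfac : (Matrix.of fun i s : Fin n => β i ^ e s) =
      Matrix.of fun i s : Fin n => β i ^ e 0 * (P.map (MvPolynomial.aeval β)) i s := by
    ext i s
    simp [P, hd s, zpow_add₀ (hβ0 i)]
  rw [hfac, Matrix.det_mul_column, ← AlgHom.coe_toRingHom, ← RingHom.mapMatrix_apply,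
    ← RingHom.map_det]
  refine mul_ne_zero (prod_ne_zero_iff.2 fun i _ => zpow_ne_zero _ (hβ0 i)) ?_
  exact fun h => hP (hβ (h.trans (map_zero (MvPolynomial.aeval β)).symm))

/-- The matrix with entries `α l ^ e s`, with rows indexed by the points and columns by `ℕ`. -/
def powMatrix {E : Type*} [Field E] (e : ℕ → ℤ) (α : ι → E) : ι → ℕ → E := fun l s => α l ^ e s

lemma fullRank_powMatrix {F E : Type*} [Field F] [Field E] [Algebra F E] {e : ℕ → ℤ}
    (he : StrictMono e) {α : ι → E} {B : Finset ι} (hα : AlgebraicIndepOn F α B) {σ : ℕ}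
    (hσ : σ ≤ #B) : FullRank (powMatrix e α) B σ := by
  classical
  obtain ⟨B₀, hB₀, hcard⟩ := exists_subset_card_eq hσ
  let g : Fin σ ≃ B₀ := (B₀.equivFinOfCardEq hcard).symm
  have hβ : AlgebraicIndependent F fun i => α (g i) :=
    hα.comp (fun i => ⟨g i, hB₀ (g i).2⟩) fun i i' h => by simpa [Subtype.ext_iff] using h
  have hdet := det_zpow_ne_zero hβ he
  set A := Matrix.of fun i s : Fin σ => α (g i) ^ e s with hA
  intro r
  let q : Fin σ → E := Matrix.vecMul (fun s : Fin σ => r s) A⁻¹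
  have hq : Matrix.vecMul q A = fun s : Fin σ => r s := by
    simp [q, Matrix.vecMul_vecMul, Matrix.nonsing_inv_mul _ (isUnit_iff_ne_zero.2 hdet)]
  refine ⟨fun l => ∑ i, if (g i : ι) = l then q i else 0, fun l hl => ?_, fun s hs => ?_⟩
  · refine sum_eq_zero fun i _ => if_neg ?_
    rintro rfl
    exact hl (hB₀ (g i).2)
  · have h1 := congrFun hq ⟨s, hs⟩
    simp only [Matrix.vecMul, dotProduct, hA, Matrix.of_apply] at h1
    rw [← h1]
    simp only [sum_mul, ite_mul, zero_mul, powMatrix]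
    rw [sum_comm]
    simp

/-- Replacing the coordinate at `j` by zero. -/
def eraseCoord [DecidableEq ι] (K : Type*) [Field K] (j : ι) : (ι → K) →ₗ[K] (ι → K) where
  toFun u l := if l = j then 0 else u l
  map_add' u v := by ext l; by_cases h : l = j <;> simp [h]
  map_smul' c u := by ext l; by_cases h : l = j <;> simp [h]

lemma finrank_map_eraseCoord_lt [DecidableEq ι] {K : Type*} [Field K] {j : ι}
    {Z : Submodule K (ι → K)} (h : Pi.single j 1 ∈ Z) :
    finrank K (Z.map (eraseCoord K j)) < finrank K Z := by
  have h1 := ((eraseCoord K j).domRestrict Z).finrank_range_add_finrank_ker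
  rw [LinearMap.range_domRestrict] at h1
  have h2 : 0 < finrank K (LinearMap.ker ((eraseCoord K j).domRestrict Z)) := by
    have hker : (⟨Pi.single j 1, h⟩ : Z) ∈ LinearMap.ker ((eraseCoord K j).domRestrict Z) := by
      ext l
      by_cases hl : l = j <;> simp [eraseCoord, hl]
    rw [pos_iff_ne_zero, Ne, Submodule.finrank_eq_zero]
    intro h0
    rw [h0, Submodule.mem_bot] at hker
    simpa using congrFun (congrArg Subtype.val hker) j
  omega

/-- Letting the point `α j` tend to infinity.  A relation among the first `σ` columns that involves
row `j` degenerates, off coordinate `j`, to an arbitrary relation among the first `σ - 1` columns: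
row `j`, scaled by its largest entry, tends to the last basis vector.  The limit is taken over the
polynomials in `(α j)⁻¹`, a quantity transcendental over the field `k` of the other points. -/
lemma finrank_iSup_erase_le [DecidableEq ι] {k E : Type*} [Field k] [Field E] [Algebra k E]
    {e : ℕ → ℤ} (he : StrictMono e) {α : ι → E} {β : ι → k} {j : ι}
    (hj : Transcendental k (α j)) {τ : Type*} (T : Finset τ) (B : τ → Finset ι) (σ : τ → ℕ)
    (hβ : ∀ t ∈ T, ∀ l ∈ B t, l ≠ j → algebraMap k E (β l) = α l)
    (hfull : ∀ t ∈ T, j ∈ B t → FullRank (powMatrix e β) ((B t).erase j) (σ t - 1)) :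
    finrank k (⨆ t ∈ T, relSpace (powMatrix e β) ((B t).erase j)
        (if j ∈ B t then σ t - 1 else σ t) : Submodule k (ι → k)) ≤
      finrank E ((⨆ t ∈ T, relSpace (powMatrix e α) (B t) (σ t)).map (eraseCoord E j)) := by
  have hj0 : α j ≠ 0 := fun h => hj (h ▸ isAlgebraic_zero)
  have hjinv : Transcendental k (α j)⁻¹ := fun h => hj (inv_inv (α j) ▸ h.inv)
  let ψ : Polynomial k →+* E := (Polynomial.aeval (α j)⁻¹ : Polynomial k →ₐ[k] E)
  have hψC : ∀ x, ψ (Polynomial.C x) = algebraMap k E x := fun x => by simp [ψ]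
  have hψX : ψ Polynomial.X = (α j)⁻¹ := by simp [ψ]
  refine finrank_iSup_le_of_lift (Polynomial.evalRingHom 0) Polynomial.C (fun x => by simp)
    ψ (transcendental_iff_injective.1 hjinv) T _ _ fun t ht u hu => ?_
  have hZ : relSpace (powMatrix e α) (B t) (σ t) ≤
      ⨆ t ∈ T, relSpace (powMatrix e α) (B t) (σ t) :=
    le_iSup₂_of_le t ht le_rfl
  by_cases hjB : j ∈ B t ∧ σ t ≠ 0
  · obtain ⟨hjB, hσ⟩ := hjB
    obtain ⟨p, hp⟩ := Nat.exists_eq_succ_of_ne_zero hσ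
    have hfull := hfull t ht hjB
    rw [if_pos hjB] at hu
    rw [hp, Nat.succ_sub_one] at hu hfull
    -- Row `j` is scaled by `α j ^ (-e p)`; at `X = 0` it is the basis vector at column `p`.
    let M : ι → ℕ → Polynomial k := fun l s =>
      if l = j then Polynomial.X ^ (e p - e s).toNat else Polynomial.C (β l ^ e s)
    have hMj : ∀ s < p + 1, Polynomial.evalRingHom 0 (M j s) = if s = p then 1 else 0 := by
      intro s hs
      by_cases hsp : s = p
      · simp [M, hsp]
      · have := he (show s < p by omega)
        have h0 : (e p - e s).toNat ≠ 0 := by omega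
        simp [M, hsp, h0]
    have hMl : ∀ l, l ≠ j → ∀ s, Polynomial.evalRingHom 0 (M l s) = powMatrix e β l s := by
      intro l hl s
      simp [M, hl, powMatrix]
    -- Prescribing the coordinate at `j` adds a freely chosen value in column `p`.
    have hsum : ∀ (a : ι → k) (x : k), a j = 0 → ∀ s < p + 1,
        ∑ l, (if l = j then x else a l) * Polynomial.evalRingHom 0 (M l s) =
          (∑ l, a l * powMatrix e β l s) + if s = p then x else 0 := by
      intro a x ha s hs
      rw [← add_sum_erase _ _ (mem_univ j), ← add_sum_erase (a := j) univ
        (fun l => a l * powMatrix e β l s) (mem_univ j), if_pos rfl, hMj s hs, ha, zero_mul,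
        zero_add, add_comm, mul_ite, mul_one, mul_zero]
      congr 1
      refine sum_congr rfl fun l hl => ?_
      rw [if_neg (ne_of_mem_erase hl), hMl l (ne_of_mem_erase hl)]
    have hMfull : FullRank (fun l s => Polynomial.evalRingHom 0 (M l s)) (B t) (p + 1) := by
      intro r
      obtain ⟨a, ha, ha'⟩ := hfull r
      have haj := ha j (by simp)
      refine ⟨fun l => if l = j then r p - ∑ l, a l * powMatrix e β l p else a l, fun l hl => ?_,
        fun s hs => ?_⟩
      · have hlj : l ≠ j := fun h => hl (h ▸ hjB)
        simp only [if_neg hlj]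
        exact ha l fun h => hl (mem_of_mem_erase h)
      · rw [hsum a _ haj s hs]
        by_cases hsp : s = p
        · simp [hsp]
        · rw [if_neg hsp, add_zero, ha' s (by omega)]
    have huj : u j = 0 := hu.1 j (by simp)
    have hu' : (fun l => if l = j then -∑ l, u l * powMatrix e β l p else u l) ∈
        relSpace (fun l s => Polynomial.evalRingHom 0 (M l s)) (B t) (p + 1) := by
      refine ⟨fun l hl => ?_, fun s hs => ?_⟩
      · have hlj : l ≠ j := fun h => hl (h ▸ hjB)
        simp only [if_neg hlj]
        exact hu.1 l fun h => hl (mem_of_mem_erase h)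
      · rw [hsum u _ huj s hs]
        by_cases hsp : s = p
        · simp [hsp]
        · rw [if_neg hsp, add_zero, hu.2 s (by omega)]
    obtain ⟨v, hv, hvB, hvM⟩ := exists_lift_relation _ Polynomial.C (fun x => by simp) M hMfull hu'
    refine ⟨fun l => if l = j then 0 else v l, fun l => ?_, ?_⟩
    · by_cases hl : l = j
      · simp [hl, huj]
      · simpa [hl] using hv l
    refine ⟨fun l => if l = j then ψ (v j) * α j ^ (-e p) else ψ (v l), hZ ⟨fun l hl => ?_,
      fun s hs => ?_⟩, ?_⟩
    · have hlj : l ≠ j := fun h => hl (h ▸ hjB)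
      simp [hlj, hvB l hl]
    · have h1 := congrArg ψ (hvM s (by omega))
      rw [map_sum, map_zero] at h1
      rw [← h1]
      refine sum_congr rfl fun l _ => ?_
      beta_reduce
      by_cases hlj : l = j
      · have hle := he.monotone (show s ≤ p by omega)
        have h2 : ψ (M j s) = α j ^ (-e p) * α j ^ e s := by
          simp only [M, if_true, map_pow, hψX]
          rw [← zpow_add₀ hj0, inv_pow, ← zpow_natCast, ← zpow_neg]
          congr 1
          omega
        rw [if_pos hlj, hlj, map_mul, h2, powMatrix]
        ring
      · rw [if_neg hlj, map_mul]
        by_cases hlB : l ∈ B t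
        · simp [M, hlj, hψC, powMatrix, hβ t ht l hlB hlj]
        · simp [hvB l hlB]
    · ext l
      by_cases hlj : l = j <;> simp [eraseCoord, hlj]
  · have hσ' : (if j ∈ B t then σ t - 1 else σ t) = σ t := by
      by_cases h : j ∈ B t
      · have : σ t = 0 := by tauto
        simp [this]
      · simp [h]
    rw [hσ'] at hu
    refine ⟨fun l => Polynomial.C (u l), fun l => by simp, fun l => algebraMap k E (u l),
      hZ ⟨fun l hl => ?_, fun s hs => ?_⟩, ?_⟩
    · simp [hu.1 l fun h => hl (mem_of_mem_erase h)]
    · have h1 := congrArg (algebraMap k E) (hu.2 s hs)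
      rw [map_sum, map_zero] at h1
      rw [← h1]
      refine sum_congr rfl fun l _ => ?_
      by_cases hl : l ∈ (B t).erase j
      · rw [mem_erase] at hl
        simp [powMatrix, hβ t ht l hl.2 hl.1]
      · simp [hu.1 l hl]
    · ext l
      by_cases hl : l = j
      · simp [eraseCoord, hl, hu.1 j]
      · simp [eraseCoord, hl, hψC]

end MonomialCode

/-! ### The dimension condition and its sufficiency -/

namespace MonomialCode

open Finset Module

/-- The dimension condition on a family of pairs `(B t, σ t)`, a family of relation spaces of
expected dimensions `#(B t) - σ t`: the expected dimensions of any nonempty subfamily `I` add up to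
at most `#(⋃ B t) - min σ t`, the expected dimension of a relation space containing them all.  The
minimum over `I` is written as an existential. -/
def HallCond {ι τ : Type*} [DecidableEq ι] (T : Finset τ) (B : τ → Finset ι) (σ : τ → ℕ) : Prop :=
  ∀ I ⊆ T, I.Nonempty → ∃ i ∈ I, ∑ t ∈ I, (#(B t) - σ t) + σ i ≤ #(I.biUnion B)

section Combinatorics

variable {ι τ : Type*} [DecidableEq ι] {T : Finset τ} {B : τ → Finset ι} {σ : τ → ℕ}

lemma HallCond.mono (h : HallCond T B σ) {T' : Finset τ} (hT : T' ⊆ T) : HallCond T' B σ :=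
  fun I hI => h I (hI.trans hT)

lemma HallCond.le_card (h : HallCond T B σ) {t : τ} (ht : t ∈ T) : σ t ≤ #(B t) := by
  obtain ⟨i, hi, hle⟩ := h {t} (by simpa using ht) (by simp)
  simp only [mem_singleton] at hi
  subst hi
  simp only [sum_singleton, singleton_biUnion] at hle
  omega

lemma biUnion_insert_update [DecidableEq τ] {I J : Finset τ} {i : τ} (hi : i ∉ J) :
    (insert i J).biUnion (Function.update B i (I.biUnion B)) = (J ∪ I).biUnion B := by
  rw [biUnion_insert, Function.update_self, union_biUnion, union_comm]
  congr 1
  refine biUnion_congr rfl fun t ht => ?_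
  rw [Function.update_of_ne]
  rintro rfl
  exact hi ht

lemma sum_insert_update [DecidableEq τ] {I J : Finset τ} {i : τ} (hi : i ∉ J)
    (hIJ : Disjoint J I) (htight : #(I.biUnion B) - σ i = ∑ t ∈ I, (#(B t) - σ t)) :
    ∑ t ∈ insert i J, (#(Function.update B i (I.biUnion B) t) - σ t) =
      ∑ t ∈ J ∪ I, (#(B t) - σ t) := by
  rw [sum_insert hi, Function.update_self, htight, sum_union hIJ, add_comm]
  congr 1
  refine sum_congr rfl fun t ht => ?_
  rw [Function.update_of_ne]
  rintro rfl
  exact hi ht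

/-- A subfamily meeting its bound with equality can be replaced by a single pair. -/
lemma HallCond.merge [DecidableEq τ] (h : HallCond T B σ) {I : Finset τ} (hI : I ⊆ T) {i : τ}
    (hi : i ∈ I) (htight : #(I.biUnion B) - σ i = ∑ t ∈ I, (#(B t) - σ t))
    (hmin : ∀ t ∈ I, σ i ≤ σ t) :
    HallCond (insert i (T \ I)) (Function.update B i (I.biUnion B)) σ := by
  intro J hJ hne
  by_cases hiJ : i ∈ J
  · have hJI : Disjoint (J.erase i) I := by
      rw [disjoint_left]
      intro t ht htI
      have := hJ (mem_of_mem_erase ht)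
      rw [mem_insert, mem_sdiff] at this
      exact this.elim (ne_of_mem_erase ht) fun h => h.2 htI
    have hsub : J.erase i ∪ I ⊆ T := by
      refine union_subset (fun t ht => ?_) hI
      have := hJ (mem_of_mem_erase ht)
      rw [mem_insert, mem_sdiff] at this
      exact this.elim (fun h => absurd h (ne_of_mem_erase ht)) And.left
    obtain ⟨t, ht, hle⟩ := h _ hsub ⟨i, mem_union_right _ hi⟩
    rw [← insert_erase hiJ, sum_insert_update (notMem_erase i J) hJI htight,
      biUnion_insert_update (notMem_erase i J)]
    rcases mem_union.1 ht with ht | ht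
    · exact ⟨t, mem_insert_of_mem ht, hle⟩
    · exact ⟨i, mem_insert_self _ _, by have := hmin t ht; omega⟩
  · have hJT : J ⊆ T := fun t ht => by
      have := hJ ht
      rw [mem_insert, mem_sdiff] at this
      exact this.elim (fun h => absurd (h ▸ ht) hiJ) And.left
    have hB : ∀ t ∈ J, Function.update B i (I.biUnion B) t = B t := fun t ht => by
      rw [Function.update_of_ne]
      rintro rfl
      exact hiJ ht
    obtain ⟨t, ht, hle⟩ := h J hJT hne
    refine ⟨t, ht, ?_⟩
    rwa [biUnion_congr rfl hB, sum_congr rfl fun t ht => by rw [hB t ht]]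

lemma card_erase_sub_le {B : Finset ι} {j : ι} {σ : ℕ} (hσ : σ ≤ #B) :
    #(B.erase j) - (if j ∈ B then σ - 1 else σ) ≤ #B - σ := by
  by_cases hj : j ∈ B
  · rw [if_pos hj, card_erase_of_mem hj]
    omega
  · rw [if_neg hj, erase_eq_of_notMem hj]

/-- The dimension condition survives the degeneration at `j`, provided that only singletons and
possibly the whole family meet their bounds with equality, and that `j` lies in a set `B i` of
smallest `σ i`.  For the whole family both sides then drop together. -/
lemma HallCond.erase (h : HallCond T B σ) {i : τ} (hi : i ∈ T) (hmin : ∀ t ∈ T, σ i ≤ σ t)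
    {j : ι} (hj : j ∈ B i)
    (hslack : ∀ I ⊆ T, 2 ≤ #I → I ≠ T →
      ∃ t ∈ I, ∑ t ∈ I, (#(B t) - σ t) + σ t + 1 ≤ #(I.biUnion B)) :
    HallCond T (fun t => (B t).erase j) (fun t => if j ∈ B t then σ t - 1 else σ t) := by
  intro I hI hne
  have hU : I.biUnion (fun t => (B t).erase j) = (I.biUnion B).erase j := by
    ext l
    simp only [mem_biUnion, mem_erase]
    tauto
  have hsum : ∑ t ∈ I, (#((B t).erase j) - (if j ∈ B t then σ t - 1 else σ t)) ≤
      ∑ t ∈ I, (#(B t) - σ t) := sum_le_sum fun t ht => card_erase_sub_le (h.le_card (hI ht))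
  have hσ' : ∀ t, (if j ∈ B t then σ t - 1 else σ t) ≤ σ t := fun t => by split_ifs <;> omega
  have hUcard := pred_card_le_card_erase (s := I.biUnion B) (a := j)
  beta_reduce
  by_cases hIT : I = T
  · subst hIT
    refine ⟨i, hi, ?_⟩
    obtain ⟨t, ht, hle⟩ := h I subset_rfl hne
    have hmin' := hmin t ht
    rw [hU, if_pos hj]
    by_cases hσ : σ i = 0
    · have hlt : ∑ t ∈ I, (#((B t).erase j) - (if j ∈ B t then σ t - 1 else σ t)) <
          ∑ t ∈ I, (#(B t) - σ t) := by
        refine sum_lt_sum (fun t ht => card_erase_sub_le (h.le_card (hI ht))) ⟨i, hi, ?_⟩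
        have : 0 < #(B i) := card_pos.2 ⟨j, hj⟩
        rw [if_pos hj, card_erase_of_mem hj]
        omega
      omega
    · omega
  · by_cases hcard : 2 ≤ #I
    · obtain ⟨t, ht, hle⟩ := hslack I hI hcard hIT
      refine ⟨t, ht, ?_⟩
      have := hσ' t
      rw [hU]
      omega
    · obtain ⟨t, rfl⟩ := card_eq_one.1 (by have := hne.card_pos; omega : #I = 1)
      refine ⟨t, mem_singleton_self t, ?_⟩
      have := h.le_card (hI (mem_singleton_self t))
      simp only [sum_singleton, singleton_biUnion]
      by_cases hjt : j ∈ B t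
      · rw [if_pos hjt, card_erase_of_mem hjt]
        omega
      · rw [if_neg hjt, erase_eq_of_notMem hjt]
        omega

lemma HallCond.sum_le_sum_erase (h : HallCond T B σ) {i : τ} (hi : i ∈ T)
    (hmin : ∀ t ∈ T, σ i ≤ σ t) {j : ι} (hj : j ∈ B i) :
    ∑ t ∈ T, (#(B t) - σ t) ≤
      ∑ t ∈ T, (#((B t).erase j) - (if j ∈ B t then σ t - 1 else σ t)) +
        if σ i = 0 then 1 else 0 := by
  classical
  have hother : ∀ t ∈ T.erase i, #(B t) - σ t ≤
      #((B t).erase j) - (if j ∈ B t then σ t - 1 else σ t) := by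
    intro t ht
    obtain ⟨hti, ht⟩ := mem_erase.1 ht
    by_cases hjt : j ∈ B t
    · have hσt : σ t ≠ 0 := by
        -- Two sets with `σ = 0` are disjoint.
        intro h0
        have h1 := hmin t ht
        obtain ⟨x, -, hle⟩ := h {t, i} (by simp [insert_subset_iff, ht, hi]) (by simp)
        rw [sum_pair hti, biUnion_insert, singleton_biUnion] at hle
        have h2 := card_union_add_card_inter (B t) (B i)
        have h3 : 0 < #(B t ∩ B i) := card_pos.2 ⟨j, mem_inter.2 ⟨hjt, hj⟩⟩
        omega
      rw [if_pos hjt, card_erase_of_mem hjt]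
      omega
    · rw [if_neg hjt, erase_eq_of_notMem hjt]
  have h1 := sum_le_sum hother
  rw [← add_sum_erase T _ hi, ← add_sum_erase T
    (fun t => #((B t).erase j) - (if j ∈ B t then σ t - 1 else σ t)) hi, if_pos hj,
    card_erase_of_mem hj]
  split_ifs <;> omega

end Combinatorics

universe u v w

open scoped IntermediateField.algebraAdjoinAdjoin in
/-- For algebraically independent points, the dimension condition forces the sum of the relation
spaces to have its expected dimension.  The field `E` varies in the induction, since points are
removed by passing to the subfield generated by the others. -/
theorem sum_le_finrank_iSup_relSpace {F : Type w} [Field F] {ι : Type*} [Fintype ι]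
    [DecidableEq ι] {τ : Type v} [DecidableEq τ] {e : ℕ → ℤ} (he : StrictMono e) (N : ℕ) :
    ∀ {E : Type u} [Field E] [Algebra F E] (α : ι → E) (T : Finset τ)
      (B : τ → Finset ι) (σ : τ → ℕ), AlgebraicIndepOn F α (T.biUnion B : Finset ι) →
      HallCond T B σ → #(T.biUnion B) + #T = N →
      ∑ t ∈ T, (#(B t) - σ t) ≤
        finrank E (⨆ t ∈ T, relSpace (powMatrix e α) (B t) (σ t) : Submodule E (ι → E)) := by
  induction N using Nat.strong_induction_on with
  | _ N ih =>
  intro E _ _ α T B σ hα hH hN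
  rcases T.eq_empty_or_nonempty with rfl | hT
  · simp
  obtain ⟨i, hi, hmin⟩ := exists_min_image T σ hT
  by_cases hBi : B i = ∅
  · -- A pair with empty support is dropped.
    have hsub : (T.erase i).biUnion B ⊆ T.biUnion B := biUnion_subset_biUnion_of_subset_left _
      (erase_subset i T)
    have h1 := ih (#((T.erase i).biUnion B) + #(T.erase i))
      (by have := card_le_card hsub; have := card_erase_lt_of_mem hi; omega) α (T.erase i) B σ
      (hα.mono (by exact_mod_cast hsub)) (hH.mono (erase_subset i T)) rfl
    rw [← add_sum_erase T _ hi, hBi]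
    simp only [card_empty, zero_tsub, zero_add]
    exact h1.trans (Submodule.finrank_mono (biSup_mono fun t ht => mem_of_mem_erase ht))
  obtain ⟨j, hj⟩ := nonempty_iff_ne_empty.2 hBi
  by_cases hslack : ∀ I ⊆ T, 2 ≤ #I → I ≠ T →
      ∃ t ∈ I, ∑ t ∈ I, (#(B t) - σ t) + σ t + 1 ≤ #(I.biUnion B)
  · -- No proper subfamily is tight: let `α j` tend to infinity.
    have hjU : j ∈ T.biUnion B := mem_biUnion.2 ⟨i, hi, hj⟩
    set S := (T.biUnion B).erase j with hS
    let k := IntermediateField.adjoin F (α '' (S : Set ι))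
    have hinsert : (T.biUnion B : Set ι) = insert j (S : Set ι) := by
      rw [← coe_insert, hS, insert_erase hjU]
    rw [hinsert] at hα
    obtain ⟨hαS, hαj⟩ := (AlgebraicIndepOn.insert_iff (by simp [hS])).1 hα
    have hαj : Transcendental k (α j) := fun h =>
      hαj ((IsFractionRing.isAlgebraic_iff _ k E).2 h)
    classical
    let β : ι → k := fun l => if h : α l ∈ k then ⟨α l, h⟩ else 0
    have hβ : ∀ l ∈ S, algebraMap k E (β l) = α l := fun l hl => by
      have : α l ∈ k := IntermediateField.subset_adjoin _ _ ⟨l, hl, rfl⟩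
      simp only [β, dif_pos this]
      rfl
    have hU : T.biUnion (fun t => (B t).erase j) = S := by
      ext l
      simp only [hS, mem_biUnion, mem_erase]
      tauto
    have hβS : AlgebraicIndepOn F β S := by
      refine ((AlgHom.algebraicIndependent_iff k.val k.val.injective).1 ?_)
      convert! hαS using 1
      ext l
      exact hβ l l.2
    have h1 := ih (#S + #T) (by rw [hS, card_erase_of_mem hjU];
                                have := card_pos.2 ⟨j, hjU⟩; omega)
      β T _ _ (by rw [hU]; exact hβS) (hH.erase hi hmin hj hslack) (by rw [hU])
    have hBS : ∀ t ∈ T, ∀ l ∈ B t, l ≠ j → l ∈ S := fun t ht l hl hlj =>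
      mem_erase.2 ⟨hlj, mem_biUnion.2 ⟨t, ht, hl⟩⟩
    have h2 := finrank_iSup_erase_le he hαj T B σ (fun t ht l hl hlj => hβ l (hBS t ht l hl hlj))
      fun t ht hjt => fullRank_powMatrix he
        (hβS.mono fun l hl => hBS t ht l (mem_of_mem_erase hl) (ne_of_mem_erase hl))
        (by have := hH.le_card ht; rw [card_erase_of_mem hjt]; omega)
    have h3 := hH.sum_le_sum_erase hi hmin hj
    by_cases hσ : σ i = 0
    · have hsingle : Pi.single j 1 ∈ ⨆ t ∈ T, relSpace (powMatrix e α) (B t) (σ t) := by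
        refine Submodule.mem_iSup_of_mem i (Submodule.mem_iSup_of_mem hi ⟨fun l hl => ?_, ?_⟩)
        · exact Pi.single_eq_of_ne (fun h => hl (by rwa [h])) _
        · simp [hσ]
      have h4 := finrank_map_eraseCoord_lt hsingle
      rw [if_pos hσ] at h3
      omega
    · have h4 := Submodule.finrank_map_le (eraseCoord E j)
        (⨆ t ∈ T, relSpace (powMatrix e α) (B t) (σ t))
      rw [if_neg hσ] at h3
      omega
  · -- A tight proper subfamily `I` spans a single relation space, which replaces it.
    push Not at hslack
    obtain ⟨I, hI, hI2, hIT, htight⟩ := hslack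
    have hIlt : #I < #T := card_lt_card (hI.ssubset_of_ne hIT)
    have hsub : I.biUnion B ⊆ T.biUnion B := biUnion_subset_biUnion_of_subset_left _ hI
    obtain ⟨m, hm, hle⟩ := hH I hI (card_pos.1 (by omega))
    have htm := htight m hm
    have hmmin : ∀ t ∈ I, σ m ≤ σ t := fun t ht => by have := htight t ht; omega
    have hd : #(I.biUnion B) - σ m = ∑ t ∈ I, (#(B t) - σ t) := by omega
    have hαI : AlgebraicIndepOn F α (I.biUnion B : Finset ι) := hα.mono (by exact_mod_cast hsub)
    have h1 := ih (#(I.biUnion B) + #I) (by have := card_le_card hsub; omega) α I B σ hαI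
      (hH.mono hI) rfl
    have hspan : (⨆ t ∈ I, relSpace (powMatrix e α) (B t) (σ t)) =
        relSpace (powMatrix e α) (I.biUnion B) (σ m) := by
      refine Submodule.eq_of_le_of_finrank_le (iSup₂_le fun t ht =>
        relSpace_mono (subset_biUnion_of_mem B ht) (hmmin t ht)) ?_
      have := finrank_relSpace_add (fullRank_powMatrix he hαI (σ := σ m) (by omega))
      omega
    have hmJ : m ∉ T \ I := fun h => (mem_sdiff.1 h).2 hm
    have hU := biUnion_insert_update (B := B) (I := I) hmJ
    have hsum := sum_insert_update (B := B) (σ := σ) hmJ sdiff_disjoint hd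
    rw [sdiff_union_of_subset hI] at hU hsum
    have h2 := ih (#(T.biUnion B) + #(insert m (T \ I)))
      (by rw [card_insert_of_notMem hmJ, card_sdiff_of_subset hI]; omega) α (insert m (T \ I))
      (Function.update B m (I.biUnion B)) σ (by rw [hU]; exact hα) (hH.merge hI hm hd hmmin)
      (by rw [hU])
    rw [hsum] at h2
    refine h2.trans (Submodule.finrank_mono (iSup₂_le fun t ht => ?_))
    by_cases htm : t = m
    · rw [htm, Function.update_self, ← hspan]
      exact biSup_mono fun t ht => hI ht
    · rw [Function.update_of_ne htm]
      exact le_iSup₂_of_le t (mem_sdiff.1 ((mem_insert.1 ht).resolve_left htm)).1 le_rfl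

end MonomialCode

/-! ### Comparison with generic matrices -/

namespace MonomialCode

open Finset Module HigherOrderMDS

/-- The sums of relation spaces have the same dimension for the powers of algebraically independent
points and for any matrix, over a larger domain, that specializes to these powers.  The sum for the
larger matrix cannot be smaller, as relations lift; and circuits that are independent there satisfy
the dimension condition, which makes the corresponding relation spaces of the specialization
independent. -/
theorem finrank_iSup_relSpace_eq {F E L R : Type*} [Field F] [Field E] [Algebra F E] [Field L]
    [CommRing R] {ι κ : Type*} [Fintype ι] [DecidableEq ι] [Fintype κ] {e : ℕ → ℤ}
    (he : StrictMono e) {α : ι → E} (hα : AlgebraicIndependent F α) (φ : R →+* E) (c : E →+* R)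
    (hc : ∀ x, φ (c x) = x) (ψ : R →+* L) (hψ : Function.Injective ψ) (M : ι → ℕ → R)
    (hM : ∀ l s, φ (M l s) = powMatrix e α l s) (B : κ → Finset ι) (σ : κ → ℕ) :
    finrank E (⨆ i, relSpace (powMatrix e α) (B i) (σ i) : Submodule E (ι → E)) =
      finrank L (⨆ i, relSpace (fun l s => ψ (M l s)) (B i) (σ i) : Submodule L (ι → L)) := by
  classical
  have hM' : (fun l s => φ (M l s)) = powMatrix e α := funext₂ hM
  have hαB : ∀ B : Finset ι, AlgebraicIndepOn F α (B : Set ι) := fun B =>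
    hα.comp _ Subtype.val_injective
  have hfull : ∀ B : Finset ι, ∀ s, s ≤ #B → FullRank (powMatrix e α) B s := fun B s hs =>
    fullRank_powMatrix he (hαB B) hs
  have hfull' : ∀ B : Finset ι, ∀ s, s ≤ #B → FullRank (fun l s => ψ (M l s)) B s :=
    fun B s hs => FullRank.of_map φ c hc ψ hψ (hM' ▸ hfull B s hs)
  apply le_antisymm
  · have h1 := finrank_iSup_le_of_lift φ c hc ψ hψ (univ : Finset κ)
      (fun i => relSpace (powMatrix e α) (B i) (σ i))
      (⨆ i, relSpace (fun l s => ψ (M l s)) (B i) (σ i)) fun i _ u hu => ?_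
    · have hsup : (⨆ i ∈ (univ : Finset κ), relSpace (powMatrix e α) (B i) (σ i)) =
          ⨆ i, relSpace (powMatrix e α) (B i) (σ i) := by simp
      rwa [hsup] at h1
    by_cases hσ : σ i ≤ #(B i)
    · obtain ⟨v, hv, hvB, hvM⟩ := exists_lift_relation φ c hc M (hM' ▸ hfull (B i) (σ i) hσ)
        (hM' ▸ hu)
      refine ⟨v, hv, Submodule.mem_iSup_of_mem i ⟨fun l hl => by simp [hvB l hl], fun s hs => ?_⟩⟩
      have := congrArg ψ (hvM s hs)
      simpa using this
    · have h0 : finrank E (relSpace (powMatrix e α) (B i) #(B i)) = 0 := by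
        have := finrank_relSpace_add (hfull (B i) _ le_rfl)
        omega
      have hu0 := relSpace_mono (M := powMatrix e α) (subset_refl (B i)) (not_le.1 hσ).le hu
      rw [Submodule.finrank_eq_zero.1 h0, Submodule.mem_bot] at hu0
      refine ⟨0, by simp [hu0], ?_⟩
      simp only [Pi.zero_apply, map_zero]
      exact zero_mem _
  · -- A basis of the sum of relation spaces of the large matrix, made of circuits.
    obtain ⟨b, hb, hspan, hli⟩ := exists_linearIndependent L
      (⋃ i, ⋃ C ∈ (B i).powersetCard (σ i + 1),
        (relSpace (fun l s => ψ (M l s)) C (σ i) : Set (ι → L)))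
    have : Finite b := hli.finite
    have := Fintype.ofFinite b
    have hle : (⨆ i, relSpace (fun l s => ψ (M l s)) (B i) (σ i)) ≤ Submodule.span L b := by
      rw [hspan]
      simp only [Submodule.span_iUnion, Submodule.span_eq]
      exact iSup_mono fun i => relSpace_le_iSup_circuits hfull' (B i)
    have hchoose : ∀ x : b, ∃ i, ∃ C ∈ (B i).powersetCard (σ i + 1),
        x.1 ∈ relSpace (fun l s => ψ (M l s)) C (σ i) := fun x => by simpa using hb x.2
    choose i C hC hxC using hchoose
    have hcard : ∀ x, #(C x) = σ (i x) + 1 := fun x => (mem_powersetCard.1 (hC x)).2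
    have hH : HallCond (univ : Finset b) C fun x => σ (i x) := by
      intro I _ hI
      obtain ⟨m, hm, hmin⟩ := exists_min_image I (fun x => σ (i x)) hI
      refine ⟨m, hm, ?_⟩
      beta_reduce at hmin ⊢
      have h1 : ∑ t ∈ I, (#(C t) - σ (i t)) = #I := by simp [hcard]
      have h2 : #(C m) ≤ #(I.biUnion C) := card_le_card (subset_biUnion_of_mem C hm)
      have hcm := hcard m
      have h3 := finrank_relSpace_add (hfull' (I.biUnion C) (σ (i m)) (by omega))
      have h4 : Submodule.span L (Set.range fun x : I => x.1.1) ≤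
          relSpace (fun l s => ψ (M l s)) (I.biUnion C) (σ (i m)) := by
        rw [Submodule.span_le]
        rintro _ ⟨x, rfl⟩
        exact relSpace_mono (subset_biUnion_of_mem C x.2) (hmin _ x.2) (hxC x)
      have h5 := finrank_span_eq_card (hli.comp _ (Subtype.val_injective (p := (· ∈ I))))
      have h6 := Submodule.finrank_mono h4
      rw [Fintype.card_coe] at h5
      have h7 : finrank L (Submodule.span L (Set.range fun x : I => x.1.1)) = #I := h5
      omega
    have h1 := sum_le_finrank_iSup_relSpace he _ α (univ : Finset b) C _ (hαB _) hH rfl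
    have h2 : ∑ x : b, (#(C x) - σ (i x)) = Fintype.card b := by simp [hcard]
    have h3 : finrank L (Submodule.span L b) = Fintype.card b := by
      have := finrank_span_eq_card hli
      rwa [Subtype.range_coe] at this
    have h4 : (⨆ x ∈ (univ : Finset b), relSpace (powMatrix e α) (C x) (σ (i x))) ≤
        ⨆ i, relSpace (powMatrix e α) (B i) (σ i) :=
      iSup₂_le fun x _ => le_iSup_of_le (i x)
        (relSpace_mono (mem_powersetCard.1 (hC x)).1 le_rfl)
    have h5 := Submodule.finrank_mono h4
    have h6 := Submodule.finrank_mono hle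
    omega

/-- The intersection of the `U_{≤ σ_i} + ⟨e_a : a ∈ A_i⟩` is the orthogonal complement of the sum of
the spaces of relations supported off `A_i`.  Relations do not see the scalar `d`, which serves to
clear denominators in `U`. -/
lemma finrank_configInter_one {K : Type*} [Field K] {n b ℓ : ℕ} (U : Matrix (Fin n) (Fin b) K)
    (N : Fin n → ℕ → K) {d : K} (hd : d ≠ 0) (hN : ∀ l (s : Fin b), N l s = d * U l s)
    (σ : Fin ℓ → ℕ) (A : Fin ℓ → Finset (Fin n)) (hσ : ∀ i, σ i ≤ b) :
    finrank K (configInter U (1 : Matrix (Fin n) (Fin n) K) σ A) =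
      n - finrank K (⨆ i, relSpace N (A i)ᶜ (σ i) : Submodule K (Fin n → K)) := by
  let D : LinearMap.BilinForm K (Fin n → K) := Matrix.toBilin' 1
  have hDapp : ∀ x y, D x y = ∑ l, x l * y l := fun x y => by
    simp [D, Matrix.toBilin'_apply', dotProduct]
  have hDsymm : ∀ x y, D x y = D y x := fun x y => by
    rw [hDapp, hDapp]
    exact sum_congr rfl fun l _ => mul_comm _ _
  have hDrefl : D.IsRefl := fun x y h => by rw [hDsymm, h]
  have hD : D.Nondegenerate := (Matrix.Nondegenerate.toBilin' (by
    exact Matrix.nondegenerate_of_det_ne_zero (by simp)))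
  have horth : ∀ i, D.orthogonal (flagSpan U (σ i) ⊔ colSpan 1 (A i)) =
      relSpace N (A i)ᶜ (σ i) := by
    intro i
    ext u
    have hker : u ∈ D.orthogonal (flagSpan U (σ i) ⊔ colSpan 1 (A i)) ↔
        flagSpan U (σ i) ⊔ colSpan 1 (A i) ≤ LinearMap.ker (D u) :=
      forall₂_congr fun x _ => by
        rw [LinearMap.mem_ker, hDsymm u x]
    rw [hker, sup_le_iff, flagSpan, colSpan, Submodule.span_le, Submodule.span_le, and_comm,
      mem_relSpace]
    refine and_congr ⟨fun h l hl => ?_, fun h => ?_⟩ ⟨fun h s hs => ?_, fun h => ?_⟩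
    · have := h ⟨l, by simpa using hl, rfl⟩
      rw [SetLike.mem_coe, LinearMap.mem_ker, hDapp] at this
      simpa [Matrix.col, Matrix.one_apply] using this
    · rintro _ ⟨l, hl, rfl⟩
      rw [SetLike.mem_coe, LinearMap.mem_ker, hDapp]
      simpa [Matrix.col, Matrix.one_apply] using h l (by simpa using hl)
    · have hsb : s < b := hs.trans_le (hσ i)
      have := h ⟨⟨s, hsb⟩, hs, rfl⟩
      rw [SetLike.mem_coe, LinearMap.mem_ker, hDapp] at this
      calc ∑ l, u l * N l s = d * ∑ l, u l * U l ⟨s, hsb⟩ := by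
            rw [mul_sum]
            refine sum_congr rfl fun l _ => ?_
            rw [hN l ⟨s, hsb⟩]
            ring
        _ = 0 := by
            rw [show ∑ l, u l * U l ⟨s, hsb⟩ = 0 from this, mul_zero]
    · rintro _ ⟨s, hs, rfl⟩
      rw [SetLike.mem_coe, LinearMap.mem_ker, hDapp]
      have h1 : d * ∑ l, u l * U l s = 0 := by
        rw [← h s hs, mul_sum]
        refine sum_congr rfl fun l _ => ?_
        rw [hN l s]
        ring
      exact (mul_eq_zero.1 h1).resolve_left hd
  have hinter : configInter U 1 σ A = D.orthogonal (⨆ i, relSpace N (A i)ᶜ (σ i)) := by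
    have h1 : ∀ i, flagSpan U (σ i) ⊔ colSpan 1 (A i) =
        D.orthogonal (relSpace N (A i)ᶜ (σ i)) := fun i => by
      rw [← horth i, LinearMap.BilinForm.orthogonal_orthogonal hD hDrefl]
    rw [configInter, iInf_congr h1]
    refine le_antisymm (fun x hx => ?_)
      (le_iInf fun i => LinearMap.BilinForm.orthogonal_le
        (le_iSup (fun i => relSpace N (A i)ᶜ (σ i)) i))
    have hle : (⨆ i, relSpace N (A i)ᶜ (σ i)) ≤ LinearMap.ker (D x) :=
      iSup_le fun i y hy => by
        rw [LinearMap.mem_ker, hDsymm]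
        exact (Submodule.mem_iInf _).1 hx i y hy
    intro y hy
    have := hle hy
    rw [LinearMap.mem_ker, hDsymm] at this
    exact this
  rw [hinter, LinearMap.BilinForm.finrank_orthogonal hD, finrank_pi, Fintype.card_fin]

/-- Configurations may be moved by an invertible matrix. -/
lemma finrank_configInter_mul {K : Type*} [Field K] {m b n ℓ : ℕ} (P : Matrix (Fin m) (Fin m) K)
    (hP : P.det ≠ 0) (U : Matrix (Fin m) (Fin b) K) (V : Matrix (Fin m) (Fin n) K)
    (σ : Fin ℓ → ℕ) (A : Fin ℓ → Finset (Fin n)) :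
    finrank K (configInter (P * U) (P * V) σ A) = finrank K (configInter U V σ A) := by
  let f : (Fin m → K) ≃ₗ[K] (Fin m → K) := P.toLinearEquiv' (P.invertibleOfIsUnitDet
    (isUnit_iff_ne_zero.2 hP))
  have hf : ∀ x, f x = P.mulVec x := fun x => rfl
  have hcol : ∀ {q : ℕ} (W : Matrix (Fin m) (Fin q) K) (s : Fin q),
      (P * W).col s = f (W.col s) := fun W s => by
    rw [hf]
    ext i
    simp [Matrix.mul_apply, Matrix.mulVec, dotProduct, Matrix.col]
  have hmap : configInter (P * U) (P * V) σ A =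
      (configInter U V σ A).map (f : (Fin m → K) →ₗ[K] (Fin m → K)) := by
    have h1 := (Submodule.orderIsoMapComap f).map_iInf
      fun i => flagSpan U (σ i) ⊔ colSpan V (A i)
    refine Eq.trans (iInf_congr fun i => ?_) h1.symm
    change _ = Submodule.map (f : (Fin m → K) →ₗ[K] (Fin m → K)) _
    rw [Submodule.map_sup, flagSpan, flagSpan, colSpan, colSpan, Submodule.map_span,
      Submodule.map_span]
    congr 2
    · ext x
      constructor
      · rintro ⟨s, hs, rfl⟩
        exact ⟨_, ⟨s, hs, rfl⟩, (hcol U s).symm⟩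
      · rintro ⟨_, ⟨s, hs, rfl⟩, rfl⟩
        exact ⟨s, hs, (hcol U s).symm⟩
    · rw [Set.image_image]
      exact Set.image_congr fun s _ => hcol V s
  rw [hmap]
  exact f.finrank_map_eq _

lemma exists_strictMono_extension {k : ℕ} (e : Fin k → ℤ) (he : StrictMono e) :
    ∃ e' : ℕ → ℤ, StrictMono e' ∧ ∀ s : Fin k, e' s = e s := by
  rcases k with _ | k
  · exact ⟨fun s => s, fun _ _ h => by simpa using h, fun s => s.elim0⟩
  refine ⟨fun s => if h : s < k + 1 then e ⟨s, h⟩ else e (Fin.last k) + s,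
    strictMono_nat_of_lt_succ fun s => ?_, fun s => dif_pos s.2⟩
  by_cases h1 : s + 1 < k + 1
  · rw [dif_pos h1, dif_pos (by omega)]
    exact he (by simp [Fin.lt_def])
  · rw [dif_neg h1]
    by_cases h2 : s < k + 1
    · rw [dif_pos h2]
      have : (⟨s, h2⟩ : Fin (k + 1)) = Fin.last k := Fin.ext (by simp; omega)
      rw [this]
      push_cast
      omega
    · rw [dif_neg h2]
      push_cast
      omega

end MonomialCode
end

theorem mainTheorem5 {F E : Type*} [Field F] [Field E] [Algebra F E] {k n : ℕ}
    (hk : 1 ≤ k) (hkn : k ≤ n) (e : Fin k → ℤ) (he : StrictMono e)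
    (α : Fin n → E) (hα : AlgebraicIndependent F α) (ℓ : ℕ) (hℓ : 1 ≤ ℓ) :
    HigherOrderMDS.IsMDSb ℓ (HigherOrderMDS.monomialMatrix e α).transpose
      (1 : Matrix (Fin n) (Fin n) E) := by
  open MonomialCode HigherOrderMDS in
  intro σ A hσ
  obtain ⟨e', he', hee'⟩ := exists_strictMono_extension e he
  let R := MvPolynomial ((Fin n × Fin k) ⊕ (Fin n × Fin n)) E
  let W : Matrix (Fin n) (Fin k) R := Matrix.of fun i j => MvPolynomial.X (Sum.inl (i, j))
  let W' : Matrix (Fin n) (Fin n) R := Matrix.of fun i j => MvPolynomial.X (Sum.inr (i, j))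
  let φ : R →+* E := MvPolynomial.eval (Sum.elim
    (fun p => (monomialMatrix e α).transpose p.1 p.2)
    (fun p => (1 : Matrix (Fin n) (Fin n) E) p.1 p.2))
  let ψ : R →+* GenericField E n k n := algebraMap _ _
  have hψ : Function.Injective ψ := IsFractionRing.injective _ _
  have hφW : W.map φ = (monomialMatrix e α).transpose := by
    ext i j
    exact MvPolynomial.eval_X _
  have hφW' : W'.map φ = 1 := by
    ext i j
    exact MvPolynomial.eval_X _
  have hψW : W.map ψ = genericBasis E n k n := rfl
  have hψW' : W'.map ψ = genericGenerator E n k n := rfl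
  have hdet : W'.det ≠ 0 := fun h0 => by
    have h1 := RingHom.map_det φ W'
    rw [RingHom.mapMatrix_apply, hφW', h0, map_zero, Matrix.det_one] at h1
    exact zero_ne_one h1
  have hdet' : (genericGenerator E n k n).det ≠ 0 := by
    rw [← hψW', ← RingHom.mapMatrix_apply, ← RingHom.map_det, Ne, map_eq_zero_iff ψ hψ]
    exact hdet
  -- The generic pair is moved to `(W'⁻¹ W, 1)`; clearing denominators makes the first matrix
  -- polynomial in the variables, and it then specializes to the powers of the `α j`.
  let M : Fin n → ℕ → R := fun l s =>
    if h : s < k then (W'.adjugate * W) l ⟨s, h⟩ else MvPolynomial.C (powMatrix e' α l s)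
  have hφM : ∀ l s, φ (M l s) = powMatrix e' α l s := by
    intro l s
    by_cases h : s < k
    · have h1 : (W'.adjugate * W).map φ = (monomialMatrix e α).transpose := by
        rw [Matrix.map_mul, hφW, ← RingHom.mapMatrix_apply, RingHom.map_adjugate,
          RingHom.mapMatrix_apply, hφW', Matrix.adjugate_one, Matrix.one_mul]
      have h2 := congrFun₂ h1 l ⟨s, h⟩
      simp only [M, dif_pos h]
      refine Eq.trans h2 ?_
      simp [monomialMatrix, powMatrix, ← hee' ⟨s, h⟩]
    · simp only [M, dif_neg h]
      exact MvPolynomial.eval_C _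
  have hψM : ∀ l (s : Fin k), ψ (M l s) = (genericGenerator E n k n).det *
      ((genericGenerator E n k n)⁻¹ * genericBasis E n k n) l s := by
    intro l s
    have h1 : (W'.adjugate * W).map ψ = (genericGenerator E n k n).det •
        ((genericGenerator E n k n)⁻¹ * genericBasis E n k n) := by
      rw [Matrix.map_mul, hψW, ← RingHom.mapMatrix_apply, RingHom.map_adjugate,
        RingHom.mapMatrix_apply, hψW', ← Matrix.smul_mul, Matrix.inv_def, smul_smul,
        Ring.mul_inverse_cancel _ (isUnit_iff_ne_zero.2 hdet'), one_smul]
    have h2 := congrFun₂ h1 l s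
    simp only [M, dif_pos s.2]
    exact h2
  have hgen := finrank_configInter_mul (genericGenerator E n k n)⁻¹
    (Matrix.isUnit_nonsing_inv_det _ (isUnit_iff_ne_zero.2 hdet')).ne_zero
    (genericBasis E n k n) (genericGenerator E n k n) σ A
  rw [Matrix.nonsing_inv_mul _ (isUnit_iff_ne_zero.2 hdet')] at hgen
  rw [← hgen, finrank_configInter_one _ (fun l s => ψ (M l s)) hdet' hψM σ A hσ,
    finrank_configInter_one _ (powMatrix e' α) one_ne_zero
      (fun l s => by simp [powMatrix, monomialMatrix, hee']) σ A hσ,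
    finrank_iSup_relSpace_eq he' hα φ MvPolynomial.C
      (fun x => MvPolynomial.eval_C x) ψ hψ M hφM]
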